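/- Let $k$ be an algebraically closed field of characteristic zero and let $H$ be a finite-dimensional Hopf algebra over $k$ with antipode $S$. Assume that $H$ is pointed, i.e. every simple subcoalgebra of $H$ is one-dimensional, and let $G(H)$ be the group of group-like elements of $H$. Call $H$ almost involutive if there is a Hopf algebra automorphism $\sigma : H \to H$ with $\sigma^2 = S^2$. (1) If the order $|G(H)|$ is odd, then $H$ is almost involutive. (2) In particular this happens if $\dim_k H$ is odd: if $\dim_k H$ is odd, then $|G(H)|$ is odd and $H$ is almost involutive. -/

import Mathlib

open scoped TensorProduct

/-- A subspace `C` of a coalgebra `H` is a subcoalgebra if `Δ(C) ⊆ C ⊗ C`, where `C ⊗ C` is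
identified with its image in `H ⊗ H`. -/
def IsSubcoalgebra {k H : Type*} [Field k] [AddCommGroup H] [Module k H] [Coalgebra k H]
    (C : Submodule k H) : Prop :=
  ∀ x ∈ C, Coalgebra.comul (R := k) x ∈ LinearMap.range (TensorProduct.map C.subtype C.subtype)

/-- A subcoalgebra is simple if it is nonzero and its only subcoalgebras are zero and itself. -/
def IsSimpleSubcoalgebra {k H : Type*} [Field k] [AddCommGroup H] [Module k H] [Coalgebra k H]
    (C : Submodule k H) : Prop :=
  IsSubcoalgebra C ∧ C ≠ ⊥ ∧ ∀ D : Submodule k H, IsSubcoalgebra D → D ≤ C → D = ⊥ ∨ D = C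

/-- A coalgebra is pointed if all its simple subcoalgebras are one-dimensional. -/
def IsPointedCoalgebra (k H : Type*) [Field k] [AddCommGroup H] [Module k H]
    [Coalgebra k H] : Prop :=
  ∀ C : Submodule k H, IsSimpleSubcoalgebra C → Module.finrank k C = 1

/-- `σ` is a companion automorphism of the Hopf algebra `H` if `S² = σ²`, with `S` the antipode.
(An automorphism of the bialgebra `H` automatically commutes with the antipode, so these are the
Hopf algebra automorphisms.) -/
def IsCompanionAutomorphism {k H : Type*} [Field k] [Ring H] [HopfAlgebra k H]
    (σ : H ≃ₐc[k] H) : Prop :=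
  ∀ x : H, HopfAlgebra.antipode k (HopfAlgebra.antipode k x) = σ (σ x)

/-- A Hopf algebra is almost involutive if it admits a companion automorphism. -/
def IsAlmostInvolutive (k H : Type*) [Field k] [Ring H] [HopfAlgebra k H] : Prop :=
  ∃ σ : H ≃ₐc[k] H, IsCompanionAutomorphism σ

/-!
Let `S` be the antipode of `H`, let `G` be the group of group-like elements, let `N = |G|`, and
write `A` for the dual algebra `H^*` with the convolution product.

*Almost involutivity.* The square `T = S²` is a bialgebra endomorphism (`antipodeSq`). The main
point is that `T ^ N` is unipotent
(`IsPointedCoalgebra.isNilpotent_antipodeSq_pow_card_sub_one`). Let `J ⊆ A` be the ideal of the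
functionals vanishing on `G`. As `H` is pointed, every simple quotient of `A` is evaluation at a
group-like element, so `J` lies in the Jacobson radical and is nilpotent. The transpose of `T ^ N`
is an algebra endomorphism of `A`, so it is unipotent once it acts trivially on `A / J` and on
`J / J²`. On `A / J` this holds because `T` fixes `G`. The dual of `J / J²` is the second
term of the coradical filtration modulo the span of `G`, and idempotents dual to the elements of `G`
split it into parts consisting of elements `y` with `Δ y ≡ y ⊗ h + g ⊗ y`. The antipode identity
gives `S y ≡ -g⁻¹ y h⁻¹`, hence `T y ≡ (h g⁻¹) y (h⁻¹ g)`, and the `N`-th iterate of this is the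
identity. Working modulo the span of `G` throughout, one needs no genuine skew-primitive
representatives.

A unipotent bialgebra endomorphism `f` has an inverse square root `ψ = p(f)` for a polynomial `p`.
It respects product and coproduct because `p(f) ⊗ p(f)` and `p(f ⊗ f)` are both unipotent
inverse square roots of `f ⊗ f`, and those are unique. If `N = 2m + 1` is odd and `ψ` is the inverse
square root of `T ^ N`, then `σ = T ^ (m + 1) ψ` satisfies `σ² = T` (`BialgHom.exists_bialgEquiv_sq_eq`).
The finiteness of the order of `S` is not needed.

*Parity.* For a group-like `g`, the bijection `x ⊗ v ↦ x₁ ⊗ x₂ v` of `H ⊗ H` conjugates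
`L_g ⊗ id` into `L_g ⊗ L_g`, so the trace `t` of left multiplication `L_g` satisfies
`t² = t · dim H`. If `g` has order two, then `t = 0`, and `dim H` is twice the rank of the projection
`(1 + L_g) / 2`. So an even `|G|` forces an even dimension.
-/

section

open Coalgebra HopfAlgebra WithConv Polynomial

/-! ### The square of the antipode -/

section AntipodeSquared

variable {k H : Type*} [Field k] [Ring H] [HopfAlgebra k H]

/-- The antipode reverses the coproduct: both sides are convolution inverses of `Δ`. For the right
hand side, write `Δ` as the convolution product of `x ↦ x ⊗ 1` and `x ↦ 1 ⊗ x`. -/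
theorem comul_comp_antipode :
    comul ∘ₗ antipode k (A := H) = TensorProduct.map (antipode k) (antipode k) ∘ₗ
      (TensorProduct.comm k H H).toLinearMap ∘ₗ comul := by
  let i₁ : H →ₐ[k] H ⊗[k] H := Algebra.TensorProduct.includeLeft
  let i₂ : H →ₐ[k] H ⊗[k] H := Algebra.TensorProduct.includeRight
  have h₁ : toConv (comul (R := k) (A := H)) = toConv i₁.toLinearMap * toConv i₂.toLinearMap := by
    ext x
    rw [(ℛ k x).convMul_apply]
    simp [i₁, i₂, (ℛ k x).eq]
  have h₂ : toConv (TensorProduct.map (antipode k) (antipode k) ∘ₗ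
      (TensorProduct.comm k H H).toLinearMap ∘ₗ comul (R := k) (A := H)) =
      toConv (i₂.toLinearMap ∘ₗ antipode k) * toConv (i₁.toLinearMap ∘ₗ antipode k) := by
    ext x
    rw [(ℛ k x).convMul_apply]
    simp [i₁, i₂, ← (ℛ k x).eq]
  have h₃ (i : H →ₐ[k] H ⊗[k] H) :
      toConv (i.toLinearMap ∘ₗ antipode k) * toConv i.toLinearMap = 1 := by
    have := LinearMap.algHom_comp_convMul_distrib i (toConv (antipode k)) (toConv LinearMap.id)
    rw [LinearMap.antipode_mul_id, LinearMap.algHom_comp_convOne] at this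
    exact (WithConv.ext this).symm
  refine (WithConv.toConv_injective (left_inv_eq_right_inv
    (a := toConv (comul (R := k) (A := H))) ?_ LinearMap.comul_right_inv)).symm
  rw [h₁, h₂, mul_assoc, ← mul_assoc (toConv (i₁.toLinearMap ∘ₗ _)), h₃, one_mul, h₃]

variable (k H) in
/-- The square of the antipode, as an algebra endomorphism. -/
noncomputable def antipodeSqAlgHom : H →ₐ[k] H :=
  .ofLinearMap (antipode k ∘ₗ antipode k) (by simp) (fun x y ↦ by simp [antipode_mul_antidistrib])

variable (k H) in
/-- The square of the antipode, as a bialgebra endomorphism. -/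
noncomputable def antipodeSq : H →ₐc[k] H :=
  .ofAlgHom (antipodeSqAlgHom k H) (by ext; simp [antipodeSqAlgHom]) (by
    ext x
    have h (y : H) : comul (R := k) (antipode k y) = TensorProduct.map (antipode k) (antipode k)
      (TensorProduct.comm k H H (comul y)) := congr($comul_comp_antipode y)
    have h' : (Algebra.TensorProduct.map (antipodeSqAlgHom k H)
        (antipodeSqAlgHom k H)).toLinearMap =
        TensorProduct.map (antipode k) (antipode k) ∘ₗ (TensorProduct.comm k H H).toLinearMap ∘ₗ
        TensorProduct.map (antipode k) (antipode k) ∘ₗ (TensorProduct.comm k H H).toLinearMap := by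
      ext; simp [antipodeSqAlgHom]
    refine congr($h' (comul x)).trans ?_
    simp [antipodeSqAlgHom, h])

@[simp]
theorem antipodeSq_apply (x : H) : antipodeSq k H x = antipode k (antipode k x) := rfl

end AntipodeSquared

/-! ### Unipotent square roots -/

section SquareRoot

variable {k V W : Type*} [Field k] [AddCommGroup V] [Module k V] [AddCommGroup W] [Module k W]

/-- The polynomial `p` approximates `X ^ (-1/2)` to order `n` at `X = 1`. -/
theorem exists_sq_mul_X_sub_one_dvd [NeZero (2 : k)] (n : ℕ) :
    ∃ p : k[X], X - 1 ∣ p - 1 ∧ (X - 1) ^ n ∣ p ^ 2 * X - 1 := by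
  have h2 : C (2⁻¹ : k) * 2 = 1 := by
    rw [← C_ofNat, ← C_mul, inv_mul_cancel₀ two_ne_zero, C_1]
  induction n with
  | zero => exact ⟨1, by simp, by simp⟩
  | succ n ih =>
    obtain ⟨p, ⟨q, hq⟩, c, hc⟩ := ih
    rcases n with _ | n
    · exact ⟨1, by simp, by simp⟩
    obtain rfl : p = 1 + (X - 1) * q := by linear_combination hq
    set Y : k[X] := X - 1 with hY
    have hX : X = Y + 1 := by simp [hY]
    rw [hX] at hc ⊢
    -- One step of Newton's iteration.
    refine ⟨1 + Y * q - Y ^ (n + 1) * C 2⁻¹ * c, ⟨q - Y ^ n * C 2⁻¹ * c, by ring⟩,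
      -c * (q * (Y + 1) + 1) + Y ^ n * (C 2⁻¹ * c) ^ 2 * (Y + 1), ?_⟩
    linear_combination hc - c * (1 + Y * q) * (Y + 1) * Y ^ (n + 1) * h2

/-- A linear map intertwining `a` and `b` intertwines every polynomial in them. -/
theorem LinearMap.comp_aeval_eq_aeval_comp {f : V →ₗ[k] W} {a : Module.End k V}
    {b : Module.End k W} (h : f ∘ₗ a = b ∘ₗ f) (p : k[X]) :
    f ∘ₗ aeval a p = aeval b p ∘ₗ f := by
  have h' (x : V) : f (a x) = b (f x) := congr($h x)
  have hn (n : ℕ) (x : V) : f ((a ^ n) x) = (b ^ n) (f x) := by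
    induction n with
    | zero => simp
    | succ n ih => simp [pow_succ', h', ih]
  ext x
  induction p using Polynomial.induction_on' with
  | add p q hp hq => simpa using congr($hp + $hq)
  | monomial n c => simp [aeval_monomial, hn, Module.algebraMap_end_apply]

/-- Unipotent square roots are unique: `a + b` is `2` plus a nilpotent, hence a unit. -/
theorem eq_of_sq_eq_sq_of_isNilpotent {R : Type*} [Ring R] (h2 : IsUnit (2 : R)) {a b : R}
    (hab : Commute a b) (ha : IsNilpotent (a - 1)) (hb : IsNilpotent (b - 1)) (h : a ^ 2 = b ^ 2) :
    a = b := by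
  have hu : IsUnit (a + b) := by
    have hc : Commute (a - 1) (b - 1) := (hab.sub_left (.one_left _)).sub_right (.one_right _)
    have : a + b = ((a - 1) + (b - 1)) + 2 := by rw [← one_add_one_eq_two]; abel
    rw [this]
    exact (hc.isNilpotent_add ha hb).isUnit_add_right_of_commute h2
      (Commute.ofNat_right _ 2)
  have : (a - b) * (a + b) = 0 := by
    rw [sub_mul, mul_add, mul_add, hab.eq, ← pow_two, ← pow_two, h]; abel
  exact sub_eq_zero.1 (hu.mul_left_eq_zero.1 this)

end SquareRoot

section SquareRoot

variable {k B : Type*} [Field k] [Ring B] [Bialgebra k B]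

theorem isNilpotent_map_sub_one {V W : Type*} [AddCommGroup V] [Module k V] [AddCommGroup W]
    [Module k W] {f : Module.End k V} {g : Module.End k W} (hf : IsNilpotent (f - 1))
    (hg : IsNilpotent (g - 1)) :
    IsNilpotent (TensorProduct.map f g - 1 : Module.End k (V ⊗[k] W)) := by
  have key : (TensorProduct.map f g - 1 : Module.End k (V ⊗[k] W)) =
      TensorProduct.map (f - 1) g + TensorProduct.map 1 (g - 1) := by
    ext; simp [TensorProduct.sub_tmul, TensorProduct.tmul_sub]
  rw [key]
  refine Commute.isNilpotent_add ?_ ?_ ?_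
  · simp only [commute_iff_eq, ← TensorProduct.map_mul]
    simp [mul_sub, sub_mul]
  · obtain ⟨n, hn⟩ := hf
    exact ⟨n, by rw [TensorProduct.map_pow, hn, TensorProduct.map_zero_left]⟩
  · obtain ⟨n, hn⟩ := hg
    exact ⟨n, by rw [TensorProduct.map_pow, hn, TensorProduct.map_zero_right]⟩

theorem BialgHom.toLinearMap_pow (T : B →ₐc[k] B) (n : ℕ) :
    ((T ^ n : B →ₐc[k] B) : B →ₗ[k] B) = ((T : B →ₗ[k] B) ^ n : Module.End k B) := by
  induction n with
  | zero => rfl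
  | succ n ih => rw [pow_succ, pow_succ, ← ih]; rfl

variable [NeZero (2 : k)]

/-- If `p` is an inverse square root on `f` and on `f ⊗ f`, it commutes with the tensor square: both
sides are unipotent inverse square roots of `f ⊗ f`. -/
theorem map_aeval_aeval_eq_aeval_map {V : Type*} [AddCommGroup V] [Module k V]
    {f : Module.End k V} {p : k[X]} (hf : IsNilpotent (f - 1)) (hp : X - 1 ∣ p - 1)
    (hp₁ : aeval f (p ^ 2 * X - 1) = 0)
    (hp₂ : aeval (TensorProduct.map f f : Module.End k (V ⊗[k] V)) (p ^ 2 * X - 1) = 0) :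
    TensorProduct.map (aeval f p) (aeval f p) =
      aeval (TensorProduct.map f f : Module.End k (V ⊗[k] V)) p := by
  have nil {M : Type _} [AddCommGroup M] [Module k M] {g : Module.End k M}
      (hg : IsNilpotent (g - 1)) : IsNilpotent (aeval g p - 1) := by
    obtain ⟨q, hq⟩ := hp
    have : aeval g p - 1 = (g - 1) * aeval g q := by simpa using congr(aeval g $hq)
    rw [this]
    refine Commute.isNilpotent_mul_right ?_ hg
    have h := (Commute.all (X - 1) q).map (aeval g)
    rwa [map_sub, aeval_X, map_one] at h
  have hc : Commute (aeval f p) f := by simpa using (Commute.all p X).map (aeval f)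
  set F : Module.End k (V ⊗[k] V) := TensorProduct.map f f
  set P : Module.End k (V ⊗[k] V) := TensorProduct.map (aeval f p) (aeval f p)
  have h₁ : P ^ 2 * F = 1 := by
    have : aeval f p ^ 2 * f = 1 := by simpa [sub_eq_zero] using hp₁
    simp only [P, F, TensorProduct.map_pow, ← TensorProduct.map_mul, this, TensorProduct.map_one]
  have h₂ : aeval F p ^ 2 * F = 1 := by simpa [sub_eq_zero] using hp₂
  have hPF : P ∘ₗ F = F ∘ₗ P := by
    change P * F = F * P
    simp only [P, F, ← TensorProduct.map_mul, hc.eq]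
  have h₂' : F * aeval F p ^ 2 = 1 := by
    rw [← h₂]
    have h := ((Commute.all (X : k[X]) (p ^ 2)).map (aeval F)).eq
    rwa [map_pow, aeval_X] at h
  refine eq_of_sq_eq_sq_of_isNilpotent ?_ (LinearMap.comp_aeval_eq_aeval_comp hPF p)
    (isNilpotent_map_sub_one (nil hf) (nil hf)) (nil (isNilpotent_map_sub_one hf hf))
    (left_inv_eq_right_inv h₁ h₂')
  have h := (two_ne_zero (α := k)).isUnit.map (algebraMap k (Module.End k (V ⊗[k] V)))
  rwa [map_ofNat] at h

/-- A unipotent bialgebra endomorphism has a bialgebra endomorphism inverse square root. -/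
theorem BialgHom.exists_sq_mul_eq_one (f : B →ₐc[k] B)
    (hf : IsNilpotent ((f : B →ₗ[k] B) - 1 : Module.End k B)) :
    ∃ (ψ : B →ₐc[k] B) (p : k[X]), (ψ : B →ₗ[k] B) = aeval (f : B →ₗ[k] B) p ∧
      ψ * ψ * f = 1 := by
  set F : Module.End k B := (f : B →ₗ[k] B) with hF
  obtain ⟨m, hm⟩ := hf
  obtain ⟨n, hn⟩ := isNilpotent_map_sub_one (k := k) ⟨m, hm⟩ ⟨m, hm⟩
  obtain ⟨p, hp, hpn⟩ := exists_sq_mul_X_sub_one_dvd (k := k) (m + n)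
  have van {M : Type _} [AddCommGroup M] [Module k M] {g : Module.End k M}
      (hg : (g - 1) ^ (m + n) = 0) : aeval g (p ^ 2 * X - 1) = 0 := by
    obtain ⟨q, hq⟩ := hpn
    simp [hq, hg]
  have h₁ := van (g := F) (by rw [pow_add, hm, zero_mul])
  have h₂ := map_aeval_aeval_eq_aeval_map ⟨m, hm⟩ hp h₁ (van (by rw [pow_add, hn, mul_zero]))
  have eval_one : aeval (1 : Module.End k k) p = 1 := by
    obtain ⟨q, hq⟩ := hp
    rw [← sub_eq_zero]
    simpa using congr(aeval (1 : Module.End k k) $hq)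
  have map_one : aeval F p 1 = 1 := by
    have : Algebra.linearMap k B ∘ₗ (1 : Module.End k k) = F ∘ₗ Algebra.linearMap k B := by
      ext; simp [F]
    simpa [eval_one] using congr($((LinearMap.comp_aeval_eq_aeval_comp this p).symm) 1)
  have map_counit : counit ∘ₗ aeval F p = counit := by
    have : counit ∘ₗ F = (1 : Module.End k k) ∘ₗ counit := by
      ext; simp [F]
    rw [LinearMap.comp_aeval_eq_aeval_comp this, eval_one]; rfl
  have map_mul : LinearMap.mul' k B ∘ₗ TensorProduct.map (aeval F p) (aeval F p) =
      aeval F p ∘ₗ LinearMap.mul' k B := by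
    rw [h₂]
    exact LinearMap.comp_aeval_eq_aeval_comp (by ext; simp [F]) p
  have map_comul : comul ∘ₗ aeval F p =
      TensorProduct.map (aeval F p) (aeval F p) ∘ₗ comul := by
    rw [h₂]
    exact LinearMap.comp_aeval_eq_aeval_comp (by simp [F]) p
  let ψ : B →ₐc[k] B :=
    { __ := aeval F p
      map_smul' := by simp
      counit_comp := map_counit
      map_comp_comul := map_comul.symm
      map_one' := map_one
      map_mul' := fun x y ↦ congr($map_mul.symm (x ⊗ₜ y))
    }
  refine ⟨ψ, p, rfl, ?_⟩
  have : aeval F p ^ 2 * F = 1 := by simpa [sub_eq_zero] using h₁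
  ext x
  exact congr($this x)

/-- A bialgebra endomorphism some odd power of which is unipotent is the square of an automorphism:
if `T ^ (2 * m + 1)` is unipotent with inverse square root `ψ`, then `T ^ (m + 1) * ψ` works. -/
theorem BialgHom.exists_bialgEquiv_sq_eq (T : B →ₐc[k] B) {n : ℕ} (hn : Odd n)
    (hT : IsNilpotent ((T : B →ₗ[k] B) ^ n - 1 : Module.End k B)) :
    ∃ σ : B ≃ₐc[k] B, ∀ x, σ (σ x) = T x := by
  rw [← BialgHom.toLinearMap_pow T] at hT
  obtain ⟨ψ, p, hψp, hψ⟩ := BialgHom.exists_sq_mul_eq_one _ hT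
  have hc : Commute T ψ := by
    apply BialgHom.coe_linearMap_injective
    change (T : B →ₗ[k] B) ∘ₗ (ψ : B →ₗ[k] B) = (ψ : B →ₗ[k] B) ∘ₗ (T : B →ₗ[k] B)
    rw [hψp]
    refine LinearMap.comp_aeval_eq_aeval_comp ?_ p
    rw [BialgHom.toLinearMap_pow T]
    exact (Commute.self_pow (T : Module.End k B) n).eq
  obtain ⟨m, rfl⟩ := hn
  have hσ : (T ^ (m + 1) * ψ) * (T ^ (m + 1) * ψ) = T := by
    rw [(hc.pow_left (m + 1)).symm.mul_mul_mul_comm, ← pow_add,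
      show m + 1 + (m + 1) = 1 + (2 * m + 1) by ring, pow_add, pow_one, mul_assoc,
      ((hc.pow_left _).mul_right (hc.pow_left _)).eq, hψ, mul_one]
  have hTu : IsUnit T := by
    have h : IsUnit (T ^ (2 * m + 1)) := by
      refine ⟨⟨T ^ (2 * m + 1), ψ * ψ, ?_, hψ⟩, rfl⟩
      rw [((hc.pow_left _).mul_right (hc.pow_left _)).eq, hψ]
    exact (isUnit_pow_iff (by simp)).1 h
  have hTb : Function.Bijective T := by
    obtain ⟨u, rfl⟩ := hTu
    exact Function.bijective_iff_has_inverse.2 ⟨⇑(u⁻¹ : (B →ₐc[k] B)ˣ).val,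
      fun x ↦ congr($u.inv_mul x), fun x ↦ congr($u.mul_inv x)⟩
  have hσ' (x : B) : (T ^ (m + 1) * ψ) ((T ^ (m + 1) * ψ) x) = T x := congr($hσ x)
  refine ⟨.ofBijective (T ^ (m + 1) * ψ) ⟨fun x y h ↦ hTb.1 ?_, fun y ↦ ?_⟩, hσ'⟩
  · rw [← hσ', h, hσ']
  · obtain ⟨x, rfl⟩ := hTb.2 y
    exact ⟨_, hσ' x⟩

end SquareRoot

/-! ### Annihilators -/

section Duality

variable {k V : Type*} [Field k] [AddCommGroup V] [Module k V]

/-- `W ⊗ W` is the common annihilator of `W^⊥ ⊗ V^*` and `V^* ⊗ W^⊥` in `V ⊗ V`. -/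
theorem mem_range_map_subtype_of_forall_dual [FiniteDimensional k V] {W : Submodule k V}
    {z : V ⊗[k] V}
    (h₁ : ∀ f g : V →ₗ[k] k, (∀ w ∈ W, f w = 0) → LinearMap.mul' k k (TensorProduct.map f g z) = 0)
    (h₂ : ∀ f g : V →ₗ[k] k, (∀ w ∈ W, g w = 0) → LinearMap.mul' k k (TensorProduct.map f g z) = 0) :
    z ∈ LinearMap.range (TensorProduct.map W.subtype W.subtype) := by
  obtain ⟨π, hπ⟩ := W.subtype.exists_leftInverse_of_injective (Submodule.ker_subtype W)
  have hπ' (w : V) (hw : w ∈ W) : (π w : V) = w := congr(($hπ ⟨w, hw⟩ : V))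
  let P : V →ₗ[k] V := W.subtype ∘ₗ π
  have sep (y : V ⊗[k] V)
      (hy : ∀ f g : V →ₗ[k] k, LinearMap.mul' k k (TensorProduct.map f g y) = 0) : y = 0 := by
    rw [← Module.forall_dual_apply_eq_zero_iff k]
    intro φ
    obtain ⟨t, rfl⟩ := (TensorProduct.dualDistribEquiv k V V).surjective φ
    induction t with
    | zero => simp
    | add s t hs ht => rw [map_add, LinearMap.add_apply, hs, ht, add_zero]
    | tmul f g => exact hy f g
  have e₁ : TensorProduct.map P LinearMap.id z = z := by
    rw [← sub_eq_zero]
    refine sep _ fun f g ↦ ?_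
    have := h₁ (f ∘ₗ P - f) g (fun w hw ↦ by simp [P, hπ' w hw])
    rw [show TensorProduct.map (f ∘ₗ P - f) g = TensorProduct.map (f ∘ₗ P) g -
      TensorProduct.map f g by ext; simp [TensorProduct.sub_tmul]] at this
    simpa [TensorProduct.map_map] using this
  have e₂ : TensorProduct.map LinearMap.id P z = z := by
    rw [← sub_eq_zero]
    refine sep _ fun f g ↦ ?_
    have := h₂ f (g ∘ₗ P - g) (fun w hw ↦ by simp [P, hπ' w hw])
    rw [show TensorProduct.map f (g ∘ₗ P - g) = TensorProduct.map f (g ∘ₗ P) -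
      TensorProduct.map f g by ext; simp [TensorProduct.tmul_sub]] at this
    simpa [TensorProduct.map_map] using this
  refine ⟨TensorProduct.map π π z, ?_⟩
  rw [TensorProduct.map_map]
  calc TensorProduct.map P P z
      = TensorProduct.map P LinearMap.id (TensorProduct.map LinearMap.id P z) := by
        rw [TensorProduct.map_map]; rfl
    _ = z := by rw [e₂, e₁]

variable {C : Type*} [AddCommGroup C] [Module k C]

/-- A functional `a` vanishing on the common zeros of a space of functionals `I` lies in `I`. -/
theorem mem_of_forall_apply_eq_zero [FiniteDimensional k C]
    {I : Submodule k (WithConv (C →ₗ[k] k))}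
    {a : WithConv (C →ₗ[k] k)} (h : ∀ x : C, (∀ b ∈ I, b x = 0) → a x = 0) : a ∈ I := by
  let e := WithConv.linearEquiv k (C →ₗ[k] k)
  let I' : Subspace k (Module.Dual k C) := I.map e.toLinearMap
  have h' : a.ofConv ∈ I' := by
    rw [← Subspace.dualCoannihilator_dualAnnihilator_eq (W := I'), Submodule.mem_dualAnnihilator]
    intro x hx
    rw [Submodule.mem_dualCoannihilator] at hx
    exact h x fun b hb ↦ hx _ ⟨b, hb, rfl⟩
  obtain ⟨b, hb, hba⟩ := h'
  rwa [← WithConv.ofConv_injective hba]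

theorem mem_of_forall_dual_apply_eq_zero {D : Submodule k C} {x : C}
    (h : ∀ a : WithConv (C →ₗ[k] k), (∀ y ∈ D, a y = 0) → a x = 0) : x ∈ D := by
  have := Subspace.forall_mem_dualAnnihilator_apply_eq_zero_iff D x
  exact this.1 fun φ hφ ↦ h (toConv φ) ((Submodule.mem_dualAnnihilator _).1 hφ)

end Duality

/-! ### The radical of the dual algebra of a pointed coalgebra -/

section Pointed

variable {k C : Type*} [Field k] [AddCommGroup C] [Module k C] [Coalgebra k C]

/-- The functionals vanishing on a subcoalgebra form a two-sided ideal of the dual algebra. -/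
theorem IsSubcoalgebra.convMul_apply_eq_zero {D : Submodule k C} (hD : IsSubcoalgebra D)
    {a b : WithConv (C →ₗ[k] k)} (h : (∀ x ∈ D, a x = 0) ∨ (∀ x ∈ D, b x = 0)) {x : C}
    (hx : x ∈ D) : (a * b) x = 0 := by
  obtain ⟨t, ht⟩ := hD x hx
  rw [LinearMap.convMul_apply, ← ht]
  clear ht
  induction t with
  | zero => simp
  | add s t hs ht => rw [map_add, map_add, map_add, hs, ht, add_zero]
  | tmul y z =>
    rcases h with h | h
    · simp [h y y.2]
    · simp [h z z.2]

theorem IsSubcoalgebra.exists_eq_span_groupLike {D : Submodule k C} (hD : IsSubcoalgebra D)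
    (h1 : Module.finrank k D = 1) : ∃ g : GroupLike k C, D = k ∙ g.val := by
  obtain ⟨⟨c, hc⟩, hc0, hcD⟩ := finrank_eq_one_iff'.1 h1
  have hD' : D = k ∙ c := by
    refine le_antisymm (fun y hy ↦ ?_) ((Submodule.span_singleton_le_iff_mem _ _).2 hc)
    obtain ⟨r, hr⟩ := hcD ⟨y, hy⟩
    exact Submodule.mem_span_singleton.2 ⟨r, congr(($hr : C))⟩
  obtain ⟨t, ht⟩ := hD c hc
  obtain ⟨r, hr⟩ : ∃ r : k, comul c = r • c ⊗ₜ[k] c := by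
    rw [← ht]
    clear ht
    induction t with
    | zero => exact ⟨0, by simp⟩
    | add s t hs ht =>
      obtain ⟨r, hr⟩ := hs
      obtain ⟨r', hr'⟩ := ht
      exact ⟨r + r', by rw [map_add, hr, hr', add_smul]⟩
    | tmul y z =>
      obtain ⟨r, rfl⟩ := hcD y
      obtain ⟨r', rfl⟩ := hcD z
      exact ⟨r' * r, by simp [TensorProduct.smul_tmul', TensorProduct.tmul_smul, mul_smul]⟩
  have hc0' : c ≠ 0 := fun h ↦ hc0 (Subtype.ext h)
  have hrc : r * counit c = 1 := by
    have := Coalgebra.rTensor_counit_comul (R := k) c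
    rw [hr] at this
    have := congr(TensorProduct.lid k C $this)
    simp [smul_smul] at this
    by_contra hne
    have h0 : (r * counit c - 1) • c = 0 := by rw [sub_smul, this, one_smul, sub_self]
    rcases smul_eq_zero.1 h0 with h | h
    · exact hne (sub_eq_zero.1 h)
    · exact hc0' h
  have hr0 : r ≠ 0 := by rintro rfl; simp at hrc
  refine ⟨⟨r • c, by simp [hrc], by
    simp [hr, TensorProduct.smul_tmul', TensorProduct.tmul_smul]⟩, ?_⟩
  rw [hD']
  exact (Submodule.span_singleton_smul_eq hr0.isUnit c).symm

/-- The coefficient space of a surjection from the dual algebra onto a simple algebra form a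
simple subcoalgebra. -/
theorem isSimpleSubcoalgebra_of_surjective [FiniteDimensional k C] {R : Type*} [Ring R]
    [IsSimpleRing R] [Algebra k R] (f : WithConv (C →ₗ[k] k) →ₐ[k] R) (hf : Function.Surjective f)
    {D : Submodule k C} (hD : ∀ x, x ∈ D ↔ ∀ a, f a = 0 → a x = 0) : IsSimpleSubcoalgebra D := by
  have hker {a : WithConv (C →ₗ[k] k)} (ha : ∀ x ∈ D, a x = 0) : f a = 0 :=
    mem_of_forall_apply_eq_zero (I := LinearMap.ker f.toLinearMap)
      fun x hx ↦ ha x ((hD x).2 fun b hb ↦ hx b hb)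
  refine ⟨fun x hx ↦ mem_range_map_subtype_of_forall_dual ?_ ?_, ?_, fun E hE hED ↦ ?_⟩
  · intro a b ha
    exact (hD x).1 hx (toConv a * toConv b) (by rw [map_mul, hker (a := toConv a) ha, zero_mul])
  · intro a b hb
    exact (hD x).1 hx (toConv a * toConv b) (by rw [map_mul, hker (a := toConv b) hb, mul_zero])
  · rintro rfl
    exact one_ne_zero ((map_one f).symm.trans (hker (by simp)))
  · -- The image of the annihilator of `E` is a two-sided ideal of the simple ring `R`.
    let I : TwoSidedIdeal R := .mk' {r | ∃ a : WithConv (C →ₗ[k] k), (∀ x ∈ E, a x = 0) ∧ f a = r}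
      ⟨0, by simp, map_zero f⟩
      (by rintro _ _ ⟨a, ha, rfl⟩ ⟨b, hb, rfl⟩
          exact ⟨a + b, fun x hx ↦ by simp [ha x hx, hb x hx], map_add f a b⟩)
      (by rintro _ ⟨a, ha, rfl⟩
          exact ⟨-a, fun x hx ↦ by simp [ha x hx], map_neg f a⟩)
      (by rintro r _ ⟨a, ha, rfl⟩
          obtain ⟨b, rfl⟩ := hf r
          exact ⟨b * a, fun x hx ↦ hE.convMul_apply_eq_zero (.inr ha) hx, map_mul f b a⟩)
      (by rintro _ r ⟨a, ha, rfl⟩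
          obtain ⟨b, rfl⟩ := hf r
          exact ⟨a * b, fun x hx ↦ hE.convMul_apply_eq_zero (.inl ha) hx, map_mul f a b⟩)
    have hI (r : R) : r ∈ I ↔ ∃ a : WithConv (C →ₗ[k] k), (∀ x ∈ E, a x = 0) ∧ f a = r :=
      TwoSidedIdeal.mem_mk' ..
    rcases eq_bot_or_eq_top I with h | h
    · refine .inr (le_antisymm hED fun x hx ↦ mem_of_forall_dual_apply_eq_zero fun a ha ↦ ?_)
      have : f a ∈ I := (hI _).2 ⟨a, ha, rfl⟩
      rw [h, TwoSidedIdeal.mem_bot] at this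
      exact (hD x).1 hx a this
    · left
      obtain ⟨a, ha, ha1⟩ := (hI 1).1 (h ▸ trivial)
      have h1 (x : C) (hx : x ∈ E) : (1 : WithConv (C →ₗ[k] k)) x = 0 := by
        have : (1 : WithConv (C →ₗ[k] k)) x - a x = 0 :=
          (hD x).1 (hED hx) (1 - a) (by simp [ha1])
        rwa [ha x hx, sub_zero] at this
      refine (Submodule.eq_bot_iff _).2 fun x hx ↦ ?_
      rw [← Module.forall_dual_apply_eq_zero_iff k]
      intro b
      have := hE.convMul_apply_eq_zero (b := toConv b) (.inl h1) hx
      rwa [one_mul] at this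

variable (k C) in
/-- The functionals on a coalgebra that vanish at the group-like elements, as a subspace of the
dual algebra. -/
def groupLikeAnnihilator : Submodule k (WithConv (C →ₗ[k] k)) where
  carrier := {a | ∀ g : GroupLike k C, a g.val = 0}
  add_mem' ha hb g := by simp [ha g, hb g]
  zero_mem' := by simp
  smul_mem' r a ha g := by simp [ha g]

theorem mem_groupLikeAnnihilator {a : WithConv (C →ₗ[k] k)} :
    a ∈ groupLikeAnnihilator k C ↔ ∀ g : GroupLike k C, a g.val = 0 := Iff.rfl

/-- By Wedderburn's theorem it suffices that `a` vanishes in every surjection `f` of the dual algebra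
onto a matrix algebra. The coefficient subcoalgebra of `f` is simple, hence spanned by a
group-like element. -/
theorem IsPointedCoalgebra.groupLikeAnnihilator_le_jacobson [IsAlgClosed k] [FiniteDimensional k C]
    (hC : IsPointedCoalgebra k C) {a : WithConv (C →ₗ[k] k)} (ha : a ∈ groupLikeAnnihilator k C) :
    a ∈ Ring.jacobson (WithConv (C →ₗ[k] k)) := by
  let A := WithConv (C →ₗ[k] k)
  have : FiniteDimensional k A :=
    .of_surjective (WithConv.linearEquiv k (C →ₗ[k] k)).symm.toLinearMap (LinearEquiv.surjective _)
  have : IsArtinianRing A := IsArtinianRing.of_finite k A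
  have : FiniteDimensional k (A ⧸ Ring.jacobson A) :=
    .of_surjective (Ideal.Quotient.mkₐ k (Ring.jacobson A)).toLinearMap Ideal.Quotient.mk_surjective
  obtain ⟨n, d, hd, ⟨e⟩⟩ :=
    IsSemisimpleRing.exists_algEquiv_pi_matrix_of_isAlgClosed k (A ⧸ Ring.jacobson A)
  rw [← Ideal.Quotient.eq_zero_iff_mem, ← map_eq_zero_iff e e.injective]
  ext1 i
  have := hd i
  let f : A →ₐ[k] Matrix (Fin (d i)) (Fin (d i)) k :=
    (Pi.evalAlgHom k (fun i ↦ Matrix (Fin (d i)) (Fin (d i)) k) i).comp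
      (e.toAlgHom.comp (Ideal.Quotient.mkₐ k _))
  have hf : Function.Surjective f := (Function.surjective_eval i).comp
    (e.surjective.comp Ideal.Quotient.mk_surjective)
  let D : Submodule k C :=
    { carrier := {x | ∀ a, f a = 0 → a x = 0}
      add_mem' := fun hx hy a h ↦ by simp [hx a h, hy a h]
      zero_mem' := by simp
      smul_mem' := fun r x hx a h ↦ by simp [hx a h] }
  have hD := isSimpleSubcoalgebra_of_surjective f hf (D := D) fun _ ↦ Iff.rfl
  obtain ⟨g, hg⟩ := hD.1.exists_eq_span_groupLike (hC D hD)
  change a ∈ LinearMap.ker f.toLinearMap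
  refine mem_of_forall_apply_eq_zero fun x hx ↦ ?_
  have : x ∈ D := hx
  rw [hg] at this
  obtain ⟨r, rfl⟩ := Submodule.mem_span_singleton.1 this
  simp [ha g]

theorem IsPointedCoalgebra.isNilpotent_groupLikeAnnihilator [IsAlgClosed k] [FiniteDimensional k C]
    (hC : IsPointedCoalgebra k C) : IsNilpotent (groupLikeAnnihilator k C) := by
  let A := WithConv (C →ₗ[k] k)
  have : FiniteDimensional k A :=
    .of_surjective (WithConv.linearEquiv k (C →ₗ[k] k)).symm.toLinearMap (LinearEquiv.surjective _)
  have : IsArtinianRing A := IsArtinianRing.of_finite k A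
  obtain ⟨n, hn⟩ := IsSemiprimaryRing.isNilpotent (R := A)
  have key (m : ℕ) : groupLikeAnnihilator k C ^ m ≤ (Ring.jacobson A ^ m).restrictScalars k := by
    induction m with
    | zero =>
      rw [Submodule.pow_zero, Submodule.pow_zero, Ideal.one_eq_top]
      exact le_top
    | succ m ih =>
      rw [Submodule.pow_succ, Submodule.pow_succ]
      exact Submodule.mul_le.2 fun a ha b hb ↦
        Ideal.mul_mem_mul (ih ha) (hC.groupLikeAnnihilator_le_jacobson hb)
  refine ⟨n, le_bot_iff.1 ((key n).trans ?_)⟩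
  rw [hn]
  exact le_rfl

end Pointed

/-! ### The antipode modulo the span of the group-like elements -/

section GroupLikeSpan

variable {k H : Type*} [Field k] [Ring H] [HopfAlgebra k H]

variable (k H) in
/-- The span of the group-like elements. -/
def groupLikeSpan : Submodule k H := Submodule.span k (Set.range (GroupLike.val (R := k) (A := H)))

theorem GroupLike.val_mem_groupLikeSpan (g : GroupLike k H) : g.val ∈ groupLikeSpan k H :=
  Submodule.subset_span ⟨g, rfl⟩

theorem apply_eq_zero_of_mem_groupLikeSpan {a : WithConv (H →ₗ[k] k)}
    (ha : a ∈ groupLikeAnnihilator k H) {x : H} (hx : x ∈ groupLikeSpan k H) : a x = 0 := by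
  change x ∈ LinearMap.ker a.ofConv
  refine Submodule.span_le.2 ?_ hx
  rintro _ ⟨g, rfl⟩
  exact ha g

theorem mem_groupLikeSpan_iff {x : H} :
    x ∈ groupLikeSpan k H ↔ ∀ a ∈ groupLikeAnnihilator k H, a x = 0 :=
  ⟨fun hx _ ha ↦ apply_eq_zero_of_mem_groupLikeSpan ha hx, fun h ↦
    mem_of_forall_dual_apply_eq_zero fun a ha ↦ h a fun g ↦ ha _ g.val_mem_groupLikeSpan⟩

theorem mul_mem_groupLikeSpan {x y : H} (hx : x ∈ groupLikeSpan k H)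
    (hy : y ∈ groupLikeSpan k H) : x * y ∈ groupLikeSpan k H := by
  have h : groupLikeSpan k H * groupLikeSpan k H ≤ groupLikeSpan k H := by
    rw [groupLikeSpan, Submodule.span_mul_span]
    refine Submodule.span_mono ?_
    rintro _ ⟨_, ⟨g, rfl⟩, _, ⟨h, rfl⟩, rfl⟩
    exact ⟨g * h, rfl⟩
  exact h (Submodule.mul_mem_mul hx hy)

theorem antipode_mem_groupLikeSpan {x : H} (hx : x ∈ groupLikeSpan k H) :
    antipode k x ∈ groupLikeSpan k H := by
  change x ∈ (groupLikeSpan k H).comap (antipode k)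
  refine Submodule.span_le.2 ?_ hx
  rintro _ ⟨g, rfl⟩
  exact (g⁻¹).val_mem_groupLikeSpan

theorem antipodeSq_val (g : GroupLike k H) : antipodeSq k H g.val = g.val :=
  g.2.antipode_antipode

theorem antipodeSq_eq_self_of_mem_groupLikeSpan {x : H} (hx : x ∈ groupLikeSpan k H) :
    antipodeSq k H x = x := by
  change x ∈ LinearMap.eqLocus (antipodeSq k H : H →ₗ[k] H) LinearMap.id
  refine Submodule.span_le.2 ?_ hx
  rintro _ ⟨g, rfl⟩
  exact antipodeSq_val g

theorem mul_antipode_map_mem_groupLikeSpan {z : H ⊗[k] H} (hz : z ∈ LinearMap.range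
    (TensorProduct.map (groupLikeSpan k H).subtype (groupLikeSpan k H).subtype)) :
    LinearMap.mul' k H ((antipode k).rTensor H z) ∈ groupLikeSpan k H := by
  obtain ⟨t, rfl⟩ := hz
  induction t with
  | zero => simp
  | add s t hs ht => simpa only [map_add] using add_mem hs ht
  | tmul x y => simpa using mul_mem_groupLikeSpan (antipode_mem_groupLikeSpan x.2) y.2

/-- `y` is skew-primitive modulo the span of the group-likes: the hypotheses say that
`Δ y ≡ y ⊗ h + g ⊗ y` modulo the tensor square of that span. Then `S y ≡ -g⁻¹ y h⁻¹`. -/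
theorem antipode_mul_add_mem_groupLikeSpan [FiniteDimensional k H] {y : H} {g h : GroupLike k H}
    (hr : ∀ a ∈ groupLikeAnnihilator k H, ∀ b : WithConv (H →ₗ[k] k),
      (a * b) y = a y * b h.val)
    (hl : ∀ a ∈ groupLikeAnnihilator k H, ∀ b : WithConv (H →ₗ[k] k),
      (b * a) y = b g.val * a y) :
    antipode k y * h.val + (g⁻¹).val * y ∈ groupLikeSpan k H := by
  have hz : comul y - y ⊗ₜ[k] h.val - g.val ⊗ₜ[k] y ∈ LinearMap.range
      (TensorProduct.map (groupLikeSpan k H).subtype (groupLikeSpan k H).subtype) := by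
    refine mem_range_map_subtype_of_forall_dual (fun a b ha ↦ ?_) (fun b a ha ↦ ?_)
    · have := hr (toConv a) (fun g ↦ ha _ g.val_mem_groupLikeSpan) (toConv b)
      rw [LinearMap.convMul_apply] at this
      simp [this, ha _ g.val_mem_groupLikeSpan]
    · have := hl (toConv a) (fun g ↦ ha _ g.val_mem_groupLikeSpan) (toConv b)
      rw [LinearMap.convMul_apply] at this
      simp [this, ha _ h.val_mem_groupLikeSpan]
  have h1 : algebraMap k H (counit y) ∈ groupLikeSpan k H := by
    rw [Algebra.algebraMap_eq_smul_one]
    exact Submodule.smul_mem _ _ (1 : GroupLike k H).val_mem_groupLikeSpan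
  have := sub_mem h1 (mul_antipode_map_mem_groupLikeSpan hz)
  rw [map_sub, map_sub, map_sub, map_sub, mul_antipode_rTensor_comul_apply] at this
  convert this using 1
  simp only [LinearMap.rTensor_tmul, LinearMap.mul'_apply, GroupLike.val_inv]
  abel

/-- Under the hypotheses of `antipode_mul_add_mem_groupLikeSpan`, `S² y ≡ (h g⁻¹) y (h⁻¹ g)`. -/
theorem antipodeSq_sub_mem_groupLikeSpan [FiniteDimensional k H] {y : H} {g h : GroupLike k H}
    (hr : ∀ a ∈ groupLikeAnnihilator k H, ∀ b : WithConv (H →ₗ[k] k),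
      (a * b) y = a y * b h.val)
    (hl : ∀ a ∈ groupLikeAnnihilator k H, ∀ b : WithConv (H →ₗ[k] k),
      (b * a) y = b g.val * a y) :
    antipodeSq k H y - (h * g⁻¹).val * y * (h⁻¹ * g).val ∈ groupLikeSpan k H := by
  set w := antipode k y * h.val + (g⁻¹).val * y with hw
  have hwm : w ∈ groupLikeSpan k H := antipode_mul_add_mem_groupLikeSpan hr hl
  have hh : h.val * (h⁻¹).val = 1 := congr(($(mul_inv_cancel h)).val)
  have hy : antipode k y = w * (h⁻¹).val - (g⁻¹).val * y * (h⁻¹).val := by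
    rw [hw, add_mul, mul_assoc (antipode k y), hh, mul_one, add_sub_cancel_right]
  have hS (u : GroupLike k H) : antipode k (u⁻¹).val = u.val := antipodeSq_val u
  have key : antipodeSq k H y - (h * g⁻¹).val * y * (h⁻¹ * g).val =
      antipode k (w * (h⁻¹).val) - h.val * (w * (h⁻¹).val) * g.val := by
    rw [antipodeSq_apply]
    nth_rw 1 [hy]
    rw [map_sub, antipode_mul_antidistrib ((g⁻¹).val * y), antipode_mul_antidistrib (g⁻¹).val,
      hS, hS, hy, GroupLike.val_mul, GroupLike.val_mul]
    noncomm_ring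
  rw [key]
  have := mul_mem_groupLikeSpan hwm (h⁻¹).val_mem_groupLikeSpan
  exact sub_mem (antipode_mem_groupLikeSpan this) (mul_mem_groupLikeSpan
    (mul_mem_groupLikeSpan h.val_mem_groupLikeSpan this) g.val_mem_groupLikeSpan)

theorem antipodeSq_pow_sub_mem_groupLikeSpan {y : H} {u v : GroupLike k H}
    (hy : antipodeSq k H y - u.val * y * v.val ∈ groupLikeSpan k H) (n : ℕ) :
    ((antipodeSq k H : H →ₗ[k] H) ^ n : Module.End k H) y - (u ^ n).val * y * (v ^ n).val ∈
      groupLikeSpan k H := by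
  induction n with
  | zero => simp
  | succ n ih =>
    have h₁ := antipode_mem_groupLikeSpan (antipode_mem_groupLikeSpan ih)
    rw [← antipodeSq_apply, map_sub, map_mul, map_mul, antipodeSq_val, antipodeSq_val] at h₁
    have h₂ := mul_mem_groupLikeSpan (mul_mem_groupLikeSpan (u ^ n).val_mem_groupLikeSpan hy)
      (v ^ n).val_mem_groupLikeSpan
    convert add_mem h₁ h₂ using 1
    rw [pow_succ', pow_succ u, pow_succ' v, GroupLike.val_mul, GroupLike.val_mul]
    simp only [Module.End.mul_apply]
    change antipodeSq k H _ - _ = _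
    noncomm_ring

theorem antipodeSq_pow_apply_of_mem_groupLikeSpan {x : H} (hx : x ∈ groupLikeSpan k H) (n : ℕ) :
    ((antipodeSq k H : H →ₗ[k] H) ^ n : Module.End k H) x = x := by
  induction n with
  | zero => simp
  | succ n ih =>
    rw [pow_succ', Module.End.mul_apply, ih]
    exact antipodeSq_eq_self_of_mem_groupLikeSpan hx

end GroupLikeSpan

/-! ### Unipotency of a power of the squared antipode -/

section Filtration

variable {k H : Type*} [Field k] [Ring H] [HopfAlgebra k H]

theorem GroupLike.convMul_apply (a b : WithConv (H →ₗ[k] k)) (g : GroupLike k H) :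
    (a * b) g.val = a g.val * b g.val := by
  simp [LinearMap.convMul_apply]

theorem GroupLike.convOne_apply (g : GroupLike k H) : (1 : WithConv (H →ₗ[k] k)) g.val = 1 := by
  simp

variable (k H) in
/-- Functionals dual to the group-like elements. -/
theorem GroupLike.exists_dual [DecidableEq (GroupLike k H)] :
    ∃ e : GroupLike k H → WithConv (H →ₗ[k] k), ∀ g h, e g h.val = if g = h then 1 else 0 := by
  have hli := linearIndep_groupLikeVal (R := k) (A := H)
  choose f hf using fun g ↦ ((Module.Basis.span hli).coord g).exists_extend
  refine ⟨fun g ↦ toConv (f g), fun g h ↦ ?_⟩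
  have h₁ : ((Module.Basis.span hli) h : H) = h.val :=
    congr(($(Module.Basis.span_apply hli h) : H))
  have h₂ := congr($(hf g) (Module.Basis.span hli h))
  rw [LinearMap.comp_apply, Submodule.subtype_apply, h₁] at h₂
  simpa [Finsupp.single_apply, eq_comm] using h₂

/-- The element `y` is the result of acting on `x` by `a` and `b` from the two sides. -/
theorem exists_forall_apply_eq_mul_mul_apply [FiniteDimensional k H] (a b : WithConv (H →ₗ[k] k))
    (x : H) : ∃ y : H, ∀ c : WithConv (H →ₗ[k] k), c y = (a * c * b) x := by
  let φ : Module.Dual k (H →ₗ[k] k) :=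
    LinearMap.applyₗ x ∘ₗ (WithConv.linearEquiv k (H →ₗ[k] k)).toLinearMap ∘ₗ
      LinearMap.mulRight k b ∘ₗ LinearMap.mulLeft k a ∘ₗ
      (WithConv.linearEquiv k (H →ₗ[k] k)).symm.toLinearMap
  obtain ⟨y, hy⟩ := (Module.evalEquiv k H).surjective φ
  exact ⟨y, fun c ↦ congr($hy c.ofConv)⟩

theorem convMul_mem_groupLikeAnnihilator_left {a : WithConv (H →ₗ[k] k)}
    (ha : a ∈ groupLikeAnnihilator k H) (b : WithConv (H →ₗ[k] k)) :
    a * b ∈ groupLikeAnnihilator k H := fun g ↦ by rw [g.convMul_apply, ha g, zero_mul]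

theorem convMul_mem_groupLikeAnnihilator_right {a : WithConv (H →ₗ[k] k)}
    (ha : a ∈ groupLikeAnnihilator k H) (b : WithConv (H →ₗ[k] k)) :
    b * a ∈ groupLikeAnnihilator k H := fun g ↦ by rw [g.convMul_apply, ha g, mul_zero]

/-- The power of `S²` by the number of group-like elements fixes, modulo their span, the second term
of the coradical filtration, which is the annihilator of `J²` for `J` the ideal of the functionals
vanishing at the group-like elements. -/
theorem antipodeSq_pow_card_sub_mem_groupLikeSpan [FiniteDimensional k H] [Finite (GroupLike k H)]
    {x : H} (hx : ∀ a ∈ groupLikeAnnihilator k H * groupLikeAnnihilator k H, a x = 0) :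
    ((antipodeSq k H : H →ₗ[k] H) ^ Nat.card (GroupLike k H) : Module.End k H) x - x ∈
      groupLikeSpan k H := by
  classical
  have := Fintype.ofFinite (GroupLike k H)
  set T : Module.End k H := (antipodeSq k H : H →ₗ[k] H) ^ Nat.card (GroupLike k H) with hT
  obtain ⟨e, he⟩ := GroupLike.exists_dual k H
  -- The components of `x` for the idempotents of `A / J` lifted to the functionals `e g`.
  choose y hy using fun p : GroupLike k H × GroupLike k H ↦
    exists_forall_apply_eq_mul_mul_apply (e p.1) (e p.2) x
  have he_left (g : GroupLike k H) (b : WithConv (H →ₗ[k] k)) :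
      e g * (b - b g.val • 1) ∈ groupLikeAnnihilator k H := by
    intro h
    rw [GroupLike.convMul_apply, he]
    split_ifs with hgh
    · simp [hgh]
    · simp
  have he_right (g : GroupLike k H) (b : WithConv (H →ₗ[k] k)) :
      (b - b g.val • 1) * e g ∈ groupLikeAnnihilator k H := by
    intro h
    rw [GroupLike.convMul_apply, he]
    split_ifs with hgh
    · simp [hgh]
    · simp
  -- Each component `y p` is fixed modulo the span, since `u y v` with `u`, `v` in the group becomes
  -- `y` again after as many iterations as the group has elements.
  have hTy (p : GroupLike k H × GroupLike k H) : T (y p) - y p ∈ groupLikeSpan k H := by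
    have h := antipodeSq_pow_sub_mem_groupLikeSpan (antipodeSq_sub_mem_groupLikeSpan (y := y p)
      (g := p.1) (h := p.2) (fun a ha b ↦ ?_) (fun a ha b ↦ ?_)) (Nat.card (GroupLike k H))
    · rwa [pow_card_eq_one', pow_card_eq_one', GroupLike.val_one, one_mul, mul_one] at h
    · have h := hx _ (Submodule.mul_mem_mul (convMul_mem_groupLikeAnnihilator_right ha (e p.1))
        (he_right p.2 b))
      have h' : e p.1 * a * ((b - b p.2.val • 1) * e p.2) =
          e p.1 * (a * b) * e p.2 - b p.2.val • (e p.1 * a * e p.2) := by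
        simp only [sub_mul, mul_sub, smul_mul_assoc, mul_smul_comm, one_mul, mul_assoc]
      rw [h'] at h
      rw [hy, hy, mul_comm]
      exact sub_eq_zero.1 h
    · have h := hx _ (Submodule.mul_mem_mul (he_left p.1 b)
        (convMul_mem_groupLikeAnnihilator_left ha (e p.2)))
      have h' : e p.1 * (b - b p.1.val • 1) * (a * e p.2) =
          e p.1 * (b * a) * e p.2 - b p.1.val • (e p.1 * a * e p.2) := by
        simp only [sub_mul, mul_sub, smul_mul_assoc, mul_smul_comm, mul_one, mul_assoc]
      rw [h'] at h
      rw [hy, hy]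
      exact sub_eq_zero.1 h
  have hE : (∑ g, e g) - 1 ∈ groupLikeAnnihilator k H := by
    intro h
    change (∑ g, e g) h.val - (1 : WithConv (H →ₗ[k] k)) h.val = 0
    rw [h.convOne_apply]
    change (WithConv.linearEquiv k (H →ₗ[k] k) (∑ g, e g)) h.val - 1 = 0
    rw [map_sum, LinearMap.sum_apply]
    change ∑ g, e g h.val - 1 = 0
    simp [he]
  have hsum : x - ∑ p, y p ∈ groupLikeSpan k H := by
    refine mem_groupLikeSpan_iff.2 fun a ha ↦ ?_
    have h₁ := hx _ (Submodule.mul_mem_mul hE (convMul_mem_groupLikeAnnihilator_left ha (∑ g, e g)))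
    have h₂ := hx _ (Submodule.mul_mem_mul ha hE)
    have h₃ : ∑ p, a (y p) = ((∑ g, e g) * a * ∑ g, e g) x := by
      change _ = (WithConv.linearEquiv k (H →ₗ[k] k) ((∑ g, e g) * a * ∑ g, e g)) x
      simp only [Finset.sum_mul, Finset.mul_sum, hy, Fintype.sum_prod_type_right, map_sum,
        LinearMap.sum_apply]
      rfl
    have h₄ : (∑ g, e g) * a * (∑ g, e g) =
        ((∑ g, e g) - 1) * (a * ∑ g, e g) + a * ((∑ g, e g) - 1) + a := by
      rw [sub_mul, mul_sub, one_mul, mul_one, mul_assoc]; abel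
    rw [map_sub, map_sum, h₃, h₄, ofConv_add, ofConv_add, LinearMap.add_apply, LinearMap.add_apply,
      h₁, h₂, zero_add, zero_add, sub_self]
  have hTx : T x - x = ∑ p, (T (y p) - y p) := by
    have := antipodeSq_pow_apply_of_mem_groupLikeSpan hsum (Nat.card (GroupLike k H))
    rw [← hT, map_sub, map_sum] at this
    rw [Finset.sum_sub_distrib]
    rw [sub_eq_sub_iff_sub_eq_sub, this]
  rw [hTx]
  exact sum_mem fun p _ ↦ hTy p

/-- With `J` the ideal of the functionals vanishing at the group-like elements, the transpose of
`S² ^ |G|` acts trivially on `A / J` and on `J / J²`, hence on every `J ^ n / J ^ (n + 1)`, and `J`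
is nilpotent. -/
theorem IsPointedCoalgebra.isNilpotent_antipodeSq_pow_card_sub_one [IsAlgClosed k]
    [FiniteDimensional k H] [Finite (GroupLike k H)] (hH : IsPointedCoalgebra k H) :
    IsNilpotent ((antipodeSq k H : H →ₗ[k] H) ^ Nat.card (GroupLike k H) - 1 :
      Module.End k H) := by
  set N := Nat.card (GroupLike k H) with hN
  set J := groupLikeAnnihilator k H with hJ
  set U : H →ₐc[k] H := (antipodeSq k H) ^ N with hU
  rw [← BialgHom.toLinearMap_pow]
  set D : Module.End k H := (U : H →ₗ[k] H) - 1 with hD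
  -- `φ` is the transpose of `U`, an algebra endomorphism, and `δ = φ - 1`.
  let φ (a : WithConv (H →ₗ[k] k)) : WithConv (H →ₗ[k] k) := toConv (a.ofConv ∘ₗ (U : H →ₗ[k] H))
  let δ (a : WithConv (H →ₗ[k] k)) : WithConv (H →ₗ[k] k) := toConv (a.ofConv ∘ₗ D)
  have hφδ (a) : φ a = a + δ a := by
    ext x
    simp [φ, δ, hD]
  have hδ_add (a b) : δ (a + b) = δ a + δ b := by
    ext x
    simp [δ]
  have hφ_mul (a b) : φ (a * b) = φ a * φ b :=
    WithConv.ext (LinearMap.convMul_comp_coalgHom_distrib a b (U : H →ₗc[k] H))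
  have hδ_mul (a b) : δ (a * b) = δ a * φ b + a * δ b := by
    have h := hφ_mul a b
    rw [hφδ, hφδ a] at h
    rw [eq_sub_of_add_eq' h, hφδ b]
    noncomm_ring
  have hU_apply (x : H) : D x = ((antipodeSq k H : H →ₗ[k] H) ^ N : Module.End k H) x - x := by
    rw [← BialgHom.toLinearMap_pow]; rfl
  have hδ_top (a) : δ a ∈ J := fun g ↦ by
    change a (D g.val) = 0
    rw [hU_apply, antipodeSq_pow_apply_of_mem_groupLikeSpan g.val_mem_groupLikeSpan, sub_self,
      map_zero]
  have hδJ (a) (ha : a ∈ J) : δ a ∈ J * J := mem_of_forall_apply_eq_zero fun x hx ↦ by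
    change a (D x) = 0
    rw [hU_apply]
    exact apply_eq_zero_of_mem_groupLikeSpan ha (antipodeSq_pow_card_sub_mem_groupLikeSpan hx)
  have hφJ (a) (ha : a ∈ J) : φ a ∈ J := by rw [hφδ]; exact add_mem ha (hδ_top a)
  have hδ_pow (n : ℕ) : ∀ a ∈ J ^ (n + 1), δ a ∈ J ^ (n + 2) := by
    induction n with
    | zero =>
      intro a ha
      rw [zero_add, Submodule.pow_one] at ha
      rw [zero_add, Submodule.pow_succ, Submodule.pow_one]
      exact hδJ a ha
    | succ n ih =>
      intro a ha
      rw [Submodule.pow_succ] at ha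
      induction ha using Submodule.mul_induction_on' with
      | mem_mul_mem a ha b hb =>
        rw [hδ_mul]
        refine add_mem ?_ ?_
        · rw [Submodule.pow_succ]
          exact Submodule.mul_mem_mul (ih a ha) (hφJ b hb)
        · have h : J ^ (n + 1) * (J * J) = J ^ (n + 1 + 2) := by
            rw [Submodule.pow_succ (n := n + 2), Submodule.pow_succ (n := n + 1)]
            exact (mul_assoc (J ^ (n + 1)) J J).symm
          exact h ▸ Submodule.mul_mem_mul ha (hδJ b hb)
      | add a _ b _ ha hb => rw [hδ_add]; exact add_mem ha hb
  have hDn (n : ℕ) (a) :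
      toConv (LinearMap.comp (WithConv.ofConv a) (D ^ (n + 1))) ∈ J ^ (n + 1) := by
    induction n with
    | zero => rw [zero_add, Submodule.pow_one, pow_one]; exact hδ_top a
    | succ n ih => exact hδ_pow n _ ih
  obtain ⟨n, hn⟩ := hH.isNilpotent_groupLikeAnnihilator
  refine ⟨n + 1, ?_⟩
  ext x
  rw [LinearMap.zero_apply, ← Module.forall_dual_apply_eq_zero_iff k]
  intro a
  have h := hDn n (toConv a)
  rw [Submodule.pow_succ, hn, Submodule.zero_eq_bot, Submodule.bot_mul] at h
  have h0 : toConv (a ∘ₗ (D ^ (n + 1) : Module.End k H)) = 0 := h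
  exact congr(($h0) x)

end Filtration

/-! ### Parity of the dimension -/

section Dimension

variable {k H : Type*} [Field k] [Ring H] [HopfAlgebra k H]

/-- The linear endomorphism `x ⊗ v ↦ ∑ x₁ ⊗ f(x₂) v` of `H ⊗ H`. -/
noncomputable def comulTwist (f : WithConv (H →ₗ[k] H)) : Module.End k (H ⊗[k] H) :=
  LinearMap.lTensor H (LinearMap.mul' k H ∘ₗ f.ofConv.rTensor H) ∘ₗ
    (TensorProduct.assoc k H H H).toLinearMap ∘ₗ comul.rTensor H

theorem comulTwist_tmul (f : WithConv (H →ₗ[k] H)) (x v : H) :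
    comulTwist f (x ⊗ₜ v) = (LinearMap.mulRight k v ∘ₗ f.ofConv).lTensor H (comul x) := by
  simp only [comulTwist, LinearMap.comp_apply, LinearMap.rTensor_tmul, LinearEquiv.coe_coe]
  generalize comul (R := k) x = t
  induction t with
  | zero => simp
  | add s t hs ht => rw [TensorProduct.add_tmul, map_add, map_add, map_add, hs, ht]
  | tmul a b => simp

theorem comulTwist_mul (f g : WithConv (H →ₗ[k] H)) :
    comulTwist g * comulTwist f = comulTwist (g * f) := by
  ext x v
  simp only [TensorProduct.AlgebraTensorModule.curry_apply, TensorProduct.curry_apply,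
    LinearMap.coe_restrictScalars, Module.End.mul_apply, comulTwist_tmul]
  let Θ : H ⊗[k] (H ⊗[k] H) →ₗ[k] H ⊗[k] H :=
    (LinearMap.mulRight k v ∘ₗ LinearMap.mul' k H ∘ₗ TensorProduct.map g.ofConv f.ofConv).lTensor H
  have h₁ (t : H ⊗[k] H) : comulTwist g ((LinearMap.mulRight k v ∘ₗ f.ofConv).lTensor H t) =
      Θ (TensorProduct.assoc k H H H (comul.rTensor H t)) := by
    induction t with
    | zero => simp
    | add s t hs ht => simp only [map_add, hs, ht]
    | tmul a b =>
      rw [LinearMap.lTensor_tmul, comulTwist_tmul, LinearMap.rTensor_tmul]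
      generalize comul (R := k) a = t
      induction t with
      | zero => simp
      | add s t hs ht => rw [TensorProduct.add_tmul, map_add, map_add, map_add, hs, ht]
      | tmul a b => simp [Θ, mul_assoc]
  rw [h₁, Coalgebra.coassoc_apply]
  exact congr($(LinearMap.lTensor_comp H (LinearMap.mulRight k v ∘ₗ LinearMap.mul' k H ∘ₗ
    TensorProduct.map g.ofConv f.ofConv) comul) (comul x)).symm

theorem comulTwist_one : comulTwist (1 : WithConv (H →ₗ[k] H)) = 1 := by
  ext x v
  simp only [TensorProduct.AlgebraTensorModule.curry_apply, TensorProduct.curry_apply,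
    LinearMap.coe_restrictScalars, comulTwist_tmul]
  have : LinearMap.mulRight k v ∘ₗ (1 : WithConv (H →ₗ[k] H)).ofConv =
      LinearMap.toSpanSingleton k H v ∘ₗ counit := by
    ext y; simp [Algebra.algebraMap_eq_smul_one]
  rw [this, LinearMap.lTensor_comp, LinearMap.comp_apply, Coalgebra.lTensor_counit_comul]
  simp

/-- The twist `x ⊗ v ↦ x₁ ⊗ x₂ v` conjugates `L_g ⊗ id` into `L_g ⊗ L_g`, so these operators have
the same trace. -/
theorem IsGroupLikeElem.trace_mulLeft_mul_self [FiniteDimensional k H] {g : H}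
    (hg : IsGroupLikeElem k g) :
    LinearMap.trace k H (LinearMap.mulLeft k g) * LinearMap.trace k H (LinearMap.mulLeft k g) =
      LinearMap.trace k H (LinearMap.mulLeft k g) * Module.finrank k H := by
  let L : Module.End k H := LinearMap.mulLeft k g
  let Ψ := comulTwist (toConv (LinearMap.id (R := k) (M := H)))
  let Ψ' := comulTwist (toConv (antipode k (A := H)))
  have hΨ : Ψ * Ψ' = 1 := by
    rw [comulTwist_mul, LinearMap.id_mul_antipode, comulTwist_one]
  have hL : (TensorProduct.map L L : Module.End k (H ⊗[k] H)) * Ψ =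
      Ψ * TensorProduct.map L LinearMap.id := by
    ext x v
    simp only [TensorProduct.AlgebraTensorModule.curry_apply, TensorProduct.curry_apply,
      LinearMap.coe_restrictScalars, Module.End.mul_apply, Ψ, TensorProduct.map_tmul,
      comulTwist_tmul, L, LinearMap.mulLeft_apply, Bialgebra.comul_mul, hg.comul_eq_tmul_self,
      LinearMap.id_apply]
    generalize comul (R := k) x = t
    induction t with
    | zero => simp
    | add s t hs ht => simp only [map_add, mul_add, hs, ht]
    | tmul a b => simp [mul_assoc]
  rw [← LinearMap.trace_tensorProduct', ← LinearMap.trace_id, ← LinearMap.trace_tensorProduct']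
  change LinearMap.trace k _ (TensorProduct.map L L) = LinearMap.trace k _ (TensorProduct.map L _)
  calc LinearMap.trace k _ (TensorProduct.map L L : Module.End k (H ⊗[k] H))
      = LinearMap.trace k _ (TensorProduct.map L L * (Ψ * Ψ')) := by rw [hΨ, mul_one]
    _ = LinearMap.trace k _ (Ψ * (TensorProduct.map L LinearMap.id * Ψ')) := by
        rw [← mul_assoc, hL, mul_assoc]
    _ = LinearMap.trace k _ (TensorProduct.map L LinearMap.id) := by
        rw [LinearMap.trace_mul_comm, mul_assoc, mul_eq_one_comm.1 hΨ, mul_one]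

/-- Since `t * t = t * dim H` for the trace `t` of `L_g`, either `t = dim H`, which forces `g = 1`,
or `t = 0`, and then `dim H` is twice the rank of the projection `(1 + L_g) / 2`. -/
theorem IsGroupLikeElem.even_finrank_of_mul_self_eq_one [CharZero k] [FiniteDimensional k H] {g : H}
    (hg : IsGroupLikeElem k g) (hg1 : g ≠ 1) (hg2 : g * g = 1) : Even (Module.finrank k H) := by
  set L : Module.End k H := LinearMap.mulLeft k g with hL
  have hLL : L * L = 1 := by
    ext x; simp [hL, ← mul_assoc, hg2]
  have h2 : (2 : k) ≠ 0 := two_ne_zero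
  let P : Module.End k H := (2⁻¹ : k) • (1 + L)
  have hP : IsIdempotentElem P := by
    have : (1 + L) * (1 + L) = (2 : k) • (1 + L) := by
      rw [mul_add, add_mul, add_mul, hLL, two_smul]; simp only [one_mul, mul_one]; abel
    simp only [IsIdempotentElem, P, smul_mul_smul_comm, this, smul_smul]
    congr 1
    field_simp
  have htr : LinearMap.trace k H P = Module.finrank k (LinearMap.range P) :=
    ((LinearMap.isProj_range_iff_isIdempotentElem P).2 hP).trace
  have htrP : 2 * LinearMap.trace k H P = Module.finrank k H + LinearMap.trace k H L := by
    simp only [P, map_smul, map_add, LinearMap.trace_one, smul_eq_mul]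
    field_simp
  have h := hg.trace_mulLeft_mul_self
  rw [← hL, mul_eq_mul_left_iff] at h
  rcases h with h | h
  · -- The projection `1 - P` has trace zero, hence vanishes, so `L = 1`.
    have hP1 : LinearMap.trace k H (1 - P) = 0 := by
      rw [map_sub, LinearMap.trace_one, sub_eq_zero]
      refine mul_left_cancel₀ h2 ?_
      rw [htrP, h]; ring
    have hP0 : 1 - P = 0 := LinearMap.IsIdempotentElem.eq_zero_of_trace_eq_zero hP.one_sub hP1
    have hPg : 1 = (2⁻¹ : k) • (1 + g) := by
      simpa [P, hL] using sub_eq_zero.1 congr($hP0 1)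
    refine absurd ?_ hg1
    have h1 := congr((2 : k) • $hPg)
    rw [smul_smul, mul_inv_cancel₀ h2, one_smul, two_smul] at h1
    replace h1 := h1.symm
    exact add_left_cancel h1
  · rw [h, add_zero, htr] at htrP
    exact even_iff_two_dvd.2 ⟨_, by exact_mod_cast htrP.symm⟩

end Dimension

/-! ### Almost involutivity -/

theorem GroupLike.finite (k H : Type*) [Field k] [Ring H] [HopfAlgebra k H]
    [FiniteDimensional k H] : Finite (GroupLike k H) :=
  (linearIndep_groupLikeVal (R := k) (A := H)).finite

theorem odd_card_groupLike_of_odd_finrank {k H : Type*} [Field k] [CharZero k] [Ring H]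
    [HopfAlgebra k H] [FiniteDimensional k H] (h : Odd (Module.finrank k H)) :
    Odd (Nat.card (GroupLike k H)) := by
  have := GroupLike.finite k H
  by_contra hG
  obtain ⟨g, hg⟩ := exists_prime_orderOf_dvd_card' (G := GroupLike k H) 2
    (even_iff_two_dvd.1 (Nat.not_odd_iff_even.1 hG))
  refine Nat.not_odd_iff_even.2 (g.2.even_finrank_of_mul_self_eq_one (fun h1 ↦ ?_) ?_) h
  · have : g = 1 := GroupLike.val_injective h1
    simp [this] at hg
  · rw [← GroupLike.val_mul, ← pow_two, ← hg, pow_orderOf_eq_one, GroupLike.val_one]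

theorem IsPointedCoalgebra.isAlmostInvolutive {k H : Type*} [Field k] [IsAlgClosed k] [CharZero k]
    [Ring H] [HopfAlgebra k H] [FiniteDimensional k H] (hH : IsPointedCoalgebra k H)
    (hG : Odd (Nat.card (GroupLike k H))) : IsAlmostInvolutive k H := by
  have := GroupLike.finite k H
  obtain ⟨σ, hσ⟩ := (antipodeSq k H).exists_bialgEquiv_sq_eq hG
    hH.isNilpotent_antipodeSq_pow_card_sub_one
  exact ⟨σ, fun x ↦ (hσ x).symm⟩

end

theorem mainTheorem2 {k H : Type*} [Field k] [IsAlgClosed k] [CharZero k]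
    [Ring H] [HopfAlgebra k H] [FiniteDimensional k H] (hH : IsPointedCoalgebra k H) :
    (Odd (Nat.card (GroupLike k H)) → IsAlmostInvolutive k H) ∧
      (Odd (Module.finrank k H) →
        Odd (Nat.card (GroupLike k H)) ∧ IsAlmostInvolutive k H) :=
  ⟨hH.isAlmostInvolutive, fun h ↦
    ⟨odd_card_groupLike_of_odd_finrank h,
      hH.isAlmostInvolutive (odd_card_groupLike_of_odd_finrank h)⟩⟩
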